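/- Throughout, $\log$ is the logarithm in base $2$. A tensor network template is a triple ${\sf Temp}=(G,d,V_{\rm filled})$, where $G=(V,E)$ is a finite oriented graph (no edge is bidirected and there are no loops), $d:E\to\mathbb N_+$ assigns a dimension to every edge, and $V_{\rm filled}\subseteq V$ is a set of vertices such that each vertex in $V_{\rm empty}=V\setminus V_{\rm filled}$ is adjacent to exactly one vertex, which lies in $V_{\rm filled}$. Edges from $V_{\rm empty}$ to $V_{\rm filled}$ are ingoing, edges from $V_{\rm filled}$ to $V_{\rm empty}$ are outgoing, and the others are internal. Placing at each filled vertex a complex tensor, with one index of range $d(e)$ for each incident edge $e$, and contracting along the internal edges gives an operator $N_*:\bigotimes_{e\ \text{ingoing}}\mathbb C^{d(e)}\to\bigotimes_{e\ \text{outgoing}}\mathbb C^{d(e)}$; the operators obtained in this way are the operators compatible with ${\sf Temp}$. Put $$\text{\sf quantum-max-flow}(\widetilde{\sf Temp})=\max_{N_*}\log\operatorname{rank}(N_*),$$ the maximum being over all operators $N_*$ compatible with ${\sf Temp}$. The flow network $\widetilde{\sf Temp}$ has as vertices the filled vertices, a source $s$ and a sink $t$. Each ingoing edge $e=(u,v)$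 gives an edge $(s,v)$ of capacity $\log d(e)$, each outgoing edge $e=(v,u)$ gives an edge $(v,t)$ of capacity $\log d(e)$, and each internal edge $e=(v,w)$ gives the two edges $(v,w)$ and $(w,v)$, both of capacity $\log d(e)$ (parallel edges are kept, so that their capacities add up). A cut is a partition of the vertices into sets $C_s\ni s$ and $C_t\ni t$, its capacity is the sum of the capacities of the edges from $C_s$ to $C_t$, and $\text{\sf min-cut}(\widetilde{\sf Temp})$ is the minimum capacity of a cut. Put $Q_{\rm cut}=\lceil\text{\sf min-cut}(\widetilde{\sf Temp})\rceil$ and $Q_{\min}=\lceil\text{\sf quantum-max-flow}(\widetilde{\sf Temp})\rceil$. Proposition. For every tensor network template ${\sf Temp}$ one has $$\text{\sf min-cut}(\widetilde{\sf Temp})\le(\log 3)\;\text{\sf quantum-max-flow}(\widetilde{\sf Temp}).$$ Moreover $Q_{\min}$ is the minimum number $q$ of memory qubits that suffices in the worst case for the exact compression of families of tensor network states with template ${\sf Temp}$: it is the least $q$ such that for every operator $N_*$ compatible with ${\sf Temp}$ and every family $(v_x)_{x\in X}$ of vectors for which all $\Psi_x=N_*v_x$ are unit vectors there are completely positive trace-preserving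 linear maps $\mathcal E$ (from the operators on the output space of $N_*$ to the operators on $(\mathbb C^2)^{\otimes q}$) and $\mathcal D$ (in the opposite direction), independent of $x$, with $\mathcal D(\mathcal E(|\Psi_x\rangle\langle\Psi_x|))=|\Psi_x\rangle\langle\Psi_x|$ for all $x$. Consequently $$Q_{\rm cut}\le(\log 3)\,Q_{\min}+1,$$ and, asymptotically, the number $Q_{\rm cut}$ of qubits used by the cut-based protocol is at most $\log 3$ times the minimum: for every $\varepsilon>0$ there is a $K$ such that $Q_{\rm cut}\le(\log 3+\varepsilon)\,Q_{\min}$ for every template with $Q_{\min}\ge K$. -/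

import Mathlib

open scoped ComplexOrder

universe u

/-! ### Tensor network templates and their operators -/

/-- A tensor network template `(G, d, V_filled)`.  The graph `G = (V, E)` is finite and oriented
(no edge is bidirected; in particular there are no loops), every edge has a positive dimension,
and every empty vertex (a vertex outside `filled`) is adjacent to exactly one vertex, and that
vertex is filled. -/
structure TensorNetworkTemplate (V : Type u) [DecidableEq V] where
  /-- the edges of the graph -/
  E : Finset (V × V)
  /-- the graph is oriented -/
  oriented : ∀ a b : V, (a, b) ∈ E → (b, a) ∉ E
  /-- the dimensions of the edges -/
  d : E → ℕ+
  /-- the filled vertices -/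
  filled : Finset V
  /-- each empty vertex is adjacent to one and only one vertex -/
  empty_adj : ∀ a : V, a ∉ filled → ∃! b : V, (a, b) ∈ E ∨ (b, a) ∈ E
  /-- the unique neighbour of an empty vertex is filled -/
  empty_adj_filled : ∀ a b : V, a ∉ filled → ((a, b) ∈ E ∨ (b, a) ∈ E) → b ∈ filled

namespace TensorNetworkTemplate

variable {V : Type u} [DecidableEq V] (T : TensorNetworkTemplate V)

/-- Ingoing edges: from an empty vertex to a filled vertex. -/
abbrev InEdge : Type u := {e : T.E // e.1.1 ∉ T.filled ∧ e.1.2 ∈ T.filled}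

/-- Outgoing edges: from a filled vertex to an empty vertex. -/
abbrev OutEdge : Type u := {e : T.E // e.1.1 ∈ T.filled ∧ e.1.2 ∉ T.filled}

/-- Internal edges: both endpoints are filled. -/
abbrev InternalEdge : Type u := {e : T.E // e.1.1 ∈ T.filled ∧ e.1.2 ∈ T.filled}

/-- The edges incident on a vertex. -/
abbrev Incident (v : V) : Type u := {e : T.E // e.1.1 = v ∨ e.1.2 = v}

/-- Values of the indices on all edges. -/
abbrev Index : Type u := (e : T.E) → Fin (T.d e)

/-- Default basis of the input space `H_in = ⨂_{e ∈ E_in} ℂ^{d(e)}`. -/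
abbrev InIndex : Type u := (e : T.InEdge) → Fin (T.d e.1)

/-- Default basis of the output space `H_out = ⨂_{e ∈ E_out} ℂ^{d(e)}`. -/
abbrev OutIndex : Type u := (e : T.OutEdge) → Fin (T.d e.1)

/-- A filling of the template: to each filled vertex `v` a complex tensor with one index, of range
`d(e)`, for each edge `e` incident on `v`. -/
abbrev Filling : Type u := (v : T.filled) → ((e : T.Incident v) → Fin (T.d e.1)) → ℂ

/-- The tensor network operator `N_* : H_in → H_out`, as a matrix in the default bases: its
entry `(k, i)` is the sum, over all values of the indices that agree with `k` on the outgoing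
edges and with `i` on the ingoing edges, of the product of the entries of all the tensors. -/
noncomputable def operator (N : T.Filling) : Matrix T.OutIndex T.InIndex ℂ :=
  fun k i => ∑ a : T.Index with (∀ e : T.OutEdge, a e.1 = k e) ∧ (∀ e : T.InEdge, a e.1 = i e),
    ∏ v : T.filled, N v (fun e => a e.1)

/-- An operator is compatible with the template if it is the operator of some tensor network
with that template. -/
def Compatible (A : Matrix T.OutIndex T.InIndex ℂ) : Prop :=
  ∃ N : T.Filling, T.operator N = A

/-- The set of values `log₂ (rank N_*)`, over all operators compatible with the template.
(The zero operator contributes `Real.logb 2 0 = 0` instead of `-∞`. This does not change the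
maximum: some compatible operator is nonzero, because all dimensions are positive.) -/
def logRanks : Set ℝ :=
  {x | ∃ A : Matrix T.OutIndex T.InIndex ℂ, T.Compatible A ∧ x = Real.logb 2 (A.rank : ℝ)}

/-- The quantum max-flow: the maximum of `log₂ (rank N_*)` over all compatible operators. -/
noncomputable def quantumMaxFlow : ℝ := sSup T.logRanks

/-- The maximum defining the quantum max-flow is attained. -/
theorem isGreatest_quantumMaxFlow : IsGreatest T.logRanks T.quantumMaxFlow := by
  have hne : T.logRanks.Nonempty := ⟨_, _, ⟨fun _ _ => 0, rfl⟩, rfl⟩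
  have hfin : T.logRanks.Finite := by
    refine ((Set.finite_Iic (Fintype.card T.InIndex)).image
      (fun n : ℕ => Real.logb 2 (n : ℝ))).subset ?_
    rintro x ⟨A, -, rfl⟩
    exact ⟨A.rank, A.rank_le_card_width, rfl⟩
  exact ⟨hne.csSup_mem hfin, fun x hx => le_csSup hfin.bddAbove hx⟩

end TensorNetworkTemplate

/-! ### Flow networks and cuts -/

/-- A flow network on the vertex set `W`, with edges indexed by `A` (parallel edges are allowed):
each edge has a tail, a head and a nonnegative capacity; `s` is the source and `t` the sink. -/
structure FlowNetwork (W A : Type u) where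
  tail : A → W
  head : A → W
  cap : A → ℝ
  cap_nonneg : ∀ a, 0 ≤ cap a
  s : W
  t : W
  s_ne_t : s ≠ t

namespace FlowNetwork

variable {W A : Type u} (N : FlowNetwork W A)

/-- A cut: a partition of the vertices in two sets, containing the source and the sink
respectively. -/
def IsCut (Cs Ct : Set W) : Prop :=
  Disjoint Cs Ct ∧ Cs ∪ Ct = Set.univ ∧ N.s ∈ Cs ∧ N.t ∈ Ct

open Classical in
/-- The capacity of a cut: the sum of the capacities of the edges going from `Cs` to `Ct`. -/
noncomputable def cutCapacity [Fintype A] (Cs Ct : Set W) : ℝ :=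
  ∑ a : A with N.tail a ∈ Cs ∧ N.head a ∈ Ct, N.cap a

/-- The set of the capacities of all cuts. -/
def cutCapacities [Fintype A] : Set ℝ :=
  {x | ∃ Cs Ct : Set W, N.IsCut Cs Ct ∧ x = N.cutCapacity Cs Ct}

/-- The min-cut: the minimum of the capacities of all cuts. -/
noncomputable def minCut [Fintype A] : ℝ := sInf N.cutCapacities

/-- The minimum defining the min-cut is attained. -/
theorem isLeast_minCut [Fintype A] [Finite W] : IsLeast N.cutCapacities N.minCut := by
  have hne : N.cutCapacities.Nonempty :=
    ⟨_, {N.s}, {N.s}ᶜ, ⟨disjoint_compl_right, Set.union_compl_self _, rfl,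
      fun h => N.s_ne_t h.symm⟩, rfl⟩
  have hfin : N.cutCapacities.Finite := by
    refine (Set.finite_range (fun C : Set W × Set W => N.cutCapacity C.1 C.2)).subset ?_
    rintro x ⟨Cs, Ct, -, rfl⟩
    exact ⟨(Cs, Ct), rfl⟩
  exact ⟨hne.csInf_mem hfin, fun x hx => csInf_le hfin.bddBelow hx⟩

end FlowNetwork

namespace TensorNetworkTemplate

variable {V : Type u} [DecidableEq V] (T : TensorNetworkTemplate V)

/-- The vertices of the flow network of a template: the filled vertices, a source and a sink. -/
inductive FlowVertex : Type u
  | source : FlowVertex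
  | sink : FlowVertex
  | node (v : T.filled) : FlowVertex

/-- A finite template yields a flow network with finitely many vertices. -/
instance : Finite T.FlowVertex := by
  refine Finite.of_surjective (α := Option (Option T.filled))
    (fun o => match o with
      | none => FlowVertex.source
      | some none => FlowVertex.sink
      | some (some v) => FlowVertex.node v) ?_
  rintro (_ | _ | v)
  exacts [⟨none, rfl⟩, ⟨some none, rfl⟩, ⟨some (some v), rfl⟩]

/-- The edges of the flow network of a template: `inl e` is the edge `e` with its own orientation,
`inr e` is the reversal of the internal edge `e`. -/
abbrev FlowEdge : Type u := T.E ⊕ T.InternalEdge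

/-- The flow network of a template: the empty vertices are removed, the ingoing edges now start
at the source and the outgoing edges now end at the sink, each internal edge is accompanied by
its reversal, and the capacities are the logarithms in base 2 of the dimensions. -/
noncomputable def flowNetwork : FlowNetwork T.FlowVertex T.FlowEdge where
  tail
    | .inl e => if h : e.1.1 ∈ T.filled then .node ⟨e.1.1, h⟩ else .source
    | .inr e => .node ⟨e.1.1.2, e.2.2⟩
  head
    | .inl e => if h : e.1.2 ∈ T.filled then .node ⟨e.1.2, h⟩ else .sink
    | .inr e => .node ⟨e.1.1.1, e.2.1⟩
  cap
    | .inl e => Real.logb 2 (T.d e : ℕ)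
    | .inr e => Real.logb 2 (T.d e.1 : ℕ)
  cap_nonneg := by
    rintro (e | e)
    · exact Real.logb_nonneg one_lt_two (by exact_mod_cast (T.d e).pos)
    · exact Real.logb_nonneg one_lt_two (by exact_mod_cast (T.d e.1).pos)
  s := .source
  t := .sink
  s_ne_t := by simp

/-- The min-cut of the flow network of the template. -/
noncomputable def minCut : ℝ := T.flowNetwork.minCut

/-- `Q_cut = ⌈min-cut⌉`, the number of memory qubits of the cut-based protocol. -/
noncomputable def qCut : ℕ := ⌈T.minCut⌉₊

/-- `Q_min = ⌈quantum-max-flow⌉`. -/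
noncomputable def qMin : ℕ := ⌈T.quantumMaxFlow⌉₊

end TensorNetworkTemplate

/-! ### Exact compression of families of pure states -/

/-- A quantum channel, from operators on `ℂ^m` to operators on `ℂ^n`: a linear map that is trace
preserving and completely positive (`id_r ⊗ Φ` maps positive semidefinite matrices to positive
semidefinite matrices, for every `r`). -/
def IsQuantumChannel {m n : Type u} [Fintype m] [Fintype n]
    (Φ : Matrix m m ℂ →ₗ[ℂ] Matrix n n ℂ) : Prop :=
  (∀ M, (Φ M).trace = M.trace) ∧
  ∀ (r : ℕ) (M : Matrix (Fin r × m) (Fin r × m) ℂ), M.PosSemidef →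
    (Matrix.of fun (x y : Fin r × n) =>
      Φ (Matrix.of fun (i j : m) => M (x.1, i) (y.1, j)) x.2 y.2).PosSemidef

/-- The default basis of a memory of `q` qubits. -/
abbrev QubitIndex (q : ℕ) : Type u := ULift.{u} (Fin q → Fin 2)

/-- The density matrix `|ψ⟩⟨ψ|`. -/
def pureState {m : Type u} (ψ : m → ℂ) : Matrix m m ℂ := Matrix.vecMulVec ψ (star ψ)

/-- The family of pure states `ψ x` can be compressed without errors into `q` memory qubits: there
are an encoding and a decoding channel, independent of `x`, whose composition leaves each state
of the family unchanged. -/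
def ExactlyCompressible {m : Type u} [Fintype m] {X : Type} (ψ : X → m → ℂ) (q : ℕ) : Prop :=
  ∃ (enc : Matrix m m ℂ →ₗ[ℂ] Matrix (QubitIndex.{u} q) (QubitIndex.{u} q) ℂ)
    (dec : Matrix (QubitIndex.{u} q) (QubitIndex.{u} q) ℂ →ₗ[ℂ] Matrix m m ℂ),
    IsQuantumChannel enc ∧ IsQuantumChannel dec ∧
    ∀ x, dec (enc (pureState (ψ x))) = pureState (ψ x)

/-- `q` memory qubits suffice in the worst case over the families of tensor network states with
template `T`: every family of normalised vectors `N_* |v_x⟩`, with `N_*` an operator compatible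
with `T`, can be compressed without errors into `q` qubits. -/
def TensorNetworkTemplate.QubitsSuffice {V : Type u} [DecidableEq V]
    (T : TensorNetworkTemplate V) (q : ℕ) : Prop :=
  ∀ A : Matrix T.OutIndex T.InIndex ℂ, T.Compatible A →
    ∀ (X : Type) (v : X → T.InIndex → ℂ),
      (∀ x, dotProduct (star (A.mulVec (v x))) (A.mulVec (v x)) = 1) →
      ExactlyCompressible (fun x => A.mulVec (v x)) q

/-! Replace an edge of dimension `d` by `⌊log₂ d⌋` qubits, and call two qubits adjacent when their
edges share a filled vertex. Menger's theorem (`exists_separator_and_links`) gives, for some `k`,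
both `k` disjoint links from ingoing to outgoing qubits and a separator of `k` qubits.

The links bound the flow from below: tensors that are indicators of "all bits of one link agree"
transport `k` independent bits, so the operator has a nonsingular diagonal submatrix of size `2 ^ k`
(`exists_filling_of_hasDisjointLinks`). The separator bounds the cut from above: the vertices still
reachable from the source form a cut all of whose crossing qubits lie in the separator
(`minCut_le_of_isSeparator`). Rounding costs a factor `log₂ 3` at most, because `d ≤ 3 ^ ⌊log₂ d⌋`;
the worst case is `d = 3`.

Compression is governed by the rank. States in the range of an operator of rank `r ≤ 2 ^ q` embed
isometrically in `q` qubits. Conversely, a code that fixes every pure state of the range fixes, by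
linearity, an `r ^ 2`-dimensional space of matrices, which forces `r ≤ 2 ^ q`
(`rank_le_of_exactlyCompressible`). -/

/-! ### Menger's theorem for disjoint connections in a finite digraph -/

section Menger

open Relation

variable {U : Type*}

/-- `b` can be reached from `a` along edges of `r` without leaving the set `W`. -/
def Linked (r : U → U → Prop) (W : Set U) (a b : U) : Prop :=
  a ∈ W ∧ ReflTransGen (fun u v => r u v ∧ u ∈ W ∧ v ∈ W) a b

/-- `S` meets every path from `A` to `B`. -/
def IsSeparator (r : U → U → Prop) (A B : Set U) (S : Finset U) : Prop :=
  ∀ a ∈ A, ∀ b ∈ B, ¬ Linked r (↑S)ᶜ a b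

/-- There are `k` pairwise disjoint sets, each of them linking `A` to `B`. -/
def HasDisjointLinks (r : U → U → Prop) (A B : Set U) (k : ℕ) : Prop :=
  ∃ W : Fin k → Set U, Pairwise (fun i j => Disjoint (W i) (W j)) ∧
    ∀ j, ∃ a ∈ A, ∃ b ∈ B, Linked r (W j) a b

/-- Menger's theorem holds for the relation `r`. -/
def MengerProperty (r : U → U → Prop) : Prop :=
  ∀ (A B : Set U) (k : ℕ), (∀ S : Finset U, IsSeparator r A B S → k ≤ S.card) →
    HasDisjointLinks r A B k

theorem Linked.mem_right {r : U → U → Prop} {W : Set U} {a b : U} (h : Linked r W a b) :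
    b ∈ W := by
  rcases h.2.cases_tail with h' | ⟨c, -, h'⟩
  · exact h' ▸ h.1
  · exact h'.2.2

theorem Linked.mono {r r' : U → U → Prop} {W W' : Set U} {a b : U} (h : Linked r W a b)
    (hW : W ⊆ W') (hr : ∀ u v, u ∈ W → v ∈ W → r u v → r' u v) : Linked r' W' a b :=
  ⟨hW h.1, ReflTransGen.mono (fun u v ⟨h1, h2, h3⟩ => ⟨hr u v h2 h3 h1, hW h2, hW h3⟩) _ _ h.2⟩

theorem Linked.trans {r : U → U → Prop} {W : Set U} {a b c : U} (h : Linked r W a b)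
    (h' : Linked r W b c) : Linked r W a c :=
  ⟨h.1, h.2.trans h'.2⟩

theorem Linked.tail {r : U → U → Prop} {W : Set U} {a b c : U} (h : Linked r W a b)
    (hr : r b c) (hc : c ∈ W) : Linked r W a c :=
  ⟨h.1, h.2.tail ⟨hr, h.mem_right, hc⟩⟩

theorem Linked.swap {r : U → U → Prop} {W : Set U} {a b : U} (h : Linked r W a b) :
    Linked (Function.swap r) W b a :=
  ⟨h.mem_right, ReflTransGen.mono (fun _ _ h' => ⟨h'.1, h'.2.2, h'.2.1⟩) _ _ h.2.swap⟩

theorem IsSeparator.swap {r : U → U → Prop} {A B : Set U} {S : Finset U}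
    (h : IsSeparator r A B S) : IsSeparator (Function.swap r) B A S :=
  fun b hb a ha hl => h a ha b hb hl.swap

theorem HasDisjointLinks.swap {r : U → U → Prop} {A B : Set U} {k : ℕ}
    (h : HasDisjointLinks r A B k) : HasDisjointLinks (Function.swap r) B A k := by
  obtain ⟨W, hW, h⟩ := h
  refine ⟨W, hW, fun j => ?_⟩
  obtain ⟨a, ha, b, hb, hl⟩ := h j
  exact ⟨b, hb, a, ha, hl.swap⟩

theorem MengerProperty.swap {r : U → U → Prop} (h : MengerProperty r) :
    MengerProperty (Function.swap r) := fun A B k hk =>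
  (h B A k fun S hS => hk S hS.swap).swap

/-- A path either avoids `Z` or has a first vertex in `Z`. -/
theorem Linked.avoids_or_hits {r : U → U → Prop} {W : Set U} {a b : U} (h : Linked r W a b)
    (Z : Set U) : Linked r (W \ Z) a b ∨
      ∃ z ∈ Z, z ∈ W ∧ ReflTransGen (fun u v => r u v ∧ u ∈ W \ Z ∧ v ∈ W) a z := by
  obtain ⟨ha, h⟩ := h
  induction h with
  | refl =>
    by_cases haZ : a ∈ Z
    · exact Or.inr ⟨a, haZ, ha, .refl⟩
    · exact Or.inl ⟨⟨ha, haZ⟩, .refl⟩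
  | @tail b c hab hbc ih =>
    rcases ih with ih | ih
    · by_cases hcZ : c ∈ Z
      · exact Or.inr ⟨c, hcZ, hbc.2.2,
          (ReflTransGen.mono (fun u v h => ⟨h.1, h.2.1, h.2.2.1⟩) _ _ ih.2).tail
            ⟨hbc.1, ih.mem_right, hbc.2.2⟩⟩
      · exact Or.inl (ih.tail hbc.1 ⟨hbc.2.2, hcZ⟩)
    · exact Or.inr ih

/-- The vertices reachable from `A` along paths all of whose vertices but the last avoid `Z`. -/
def reachBefore (r : U → U → Prop) (A Z : Set U) : Set U :=
  {w | ∃ a ∈ A, ReflTransGen (fun u v => r u v ∧ u ∉ Z) a w}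

/-- If `Z` is a separator of the minimal size `k` for `r`, and `r'` contains all edges of `r` that
start outside `Z`, then `A` and `Z` are joined by `k` disjoint links before `Z`. -/
theorem MengerProperty.exists_links_to_separator {r r' : U → U → Prop} (hM : MengerProperty r')
    {A B : Set U} {Z : Finset U} {k : ℕ}
    (hr : ∀ u v, u ∉ Z → r u v → r' u v)
   
    (hmin : ∀ S : Finset U, IsSeparator r A B S → k ≤ S.card) (hZ : IsSeparator r A B Z) :
    ∃ (W : Fin k → Set U) (s : Fin k → U),
      Pairwise (fun i j => Disjoint (W i) (W j)) ∧
      ∀ j, ∃ a ∈ A, s j ∈ Z ∧ Linked r' (W j) a (s j) ∧ W j ⊆ reachBefore r' A Z := by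
  -- A path from `A` to `B` must hit `Z`. Up to its first hit it uses only edges starting outside
  -- `Z`, which are edges of `r'`; so a set separating `A` from `Z` in `r'` separates `A` from `B`
  -- in `r`.
  have hsep : ∀ S : Finset U, IsSeparator r' A Z S → k ≤ S.card := by
    intro S hS
    refine hmin S fun a ha b hb hl => ?_
    rcases hl.avoids_or_hits (Z : Set U) with h | ⟨z, hz, -, h⟩
    · exact hZ a ha b hb (h.mono (fun u hu => hu.2) fun _ _ _ _ h => h)
    · exact hS a ha z hz ⟨hl.1,
        ReflTransGen.mono (fun u v h => ⟨hr u v h.2.1.2 h.1, h.2.1.1, h.2.2⟩) _ _ h⟩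
  obtain ⟨W, hW, hl⟩ := hM A Z k hsep
  -- Cut each link at its first vertex in `Z`.
  have key : ∀ j, ∃ s ∈ Z, ∃ a ∈ A, Linked r' (W j ∩ reachBefore r' A Z) a s := by
    intro j
    obtain ⟨a, ha, b, hb, h⟩ := hl j
    rcases h.avoids_or_hits (Z : Set U) with h' | ⟨z, hz, hzW, h'⟩
    · exact absurd hb h'.mem_right.2
    · refine ⟨z, hz, a, ha, ⟨h.1, a, ha, .refl⟩, ?_⟩
      clear hz hzW
      induction h' with
      | refl => exact .refl
      | @tail b c hab hbc ih =>
        have hb' : ReflTransGen (fun u v => r' u v ∧ u ∉ (Z : Set U)) a b :=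
          ReflTransGen.mono (fun u v h => ⟨h.1, h.2.1.2⟩) _ _ hab
        exact ih.tail ⟨hbc.1, ⟨hbc.2.1.1, a, ha, hb'⟩,
          ⟨hbc.2.2, a, ha, hb'.tail ⟨hbc.1, hbc.2.1.2⟩⟩⟩
  choose s hs a ha hla using key
  exact ⟨fun j => W j ∩ reachBefore r' A Z, s,
    fun i j hij => (hW hij).mono Set.inter_subset_left Set.inter_subset_left,
    fun j => ⟨a j, ha j, hs j, hla j, Set.inter_subset_right⟩⟩

theorem exists_linked_of_mem_reachBefore {r : U → U → Prop} {A Z S : Set U} {w : U}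
    (h : w ∈ reachBefore r A Z) (hSZ : S ⊆ Z) (hw : w ∉ S) : ∃ a ∈ A, Linked r Sᶜ a w := by
  obtain ⟨a, ha, h⟩ := h
  refine ⟨a, ha, ?_⟩
  clear ha
  induction h using ReflTransGen.head_induction_on with
  | refl => exact ⟨hw, .refl⟩
  | head hac _ ih =>
    have := fun h => hac.2 (hSZ h)
    exact ⟨this, ih.2.head ⟨hac.1, this, ih.1⟩⟩

theorem injective_of_mem_disjoint {ι : Type*} {W : ι → Set U} {s : ι → U}
    (hW : Pairwise (fun i j => Disjoint (W i) (W j))) (hs : ∀ j, s j ∈ W j) {w : U} {i j : ι}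
    (hw : w ∈ W i) (h : s j = w) : i = j := by
  by_contra hij
  exact Set.disjoint_left.1 (hW hij) hw (h ▸ hs j)

/-- Without edges a link is a single vertex of `A ∩ B`, and `A ∩ B` itself is a separator. -/
theorem mengerProperty_of_isEmpty [Finite U] {r : U → U → Prop} (hr : ∀ u v, ¬ r u v) :
    MengerProperty r := by
  intro A B k hk
  have hfin := Set.toFinite (A ∩ B)
  have hc : k ≤ hfin.toFinset.card := by
    refine hk _ fun a ha b hb hl => ?_
    rcases hl.2.cases_tail with h | ⟨c, -, h⟩
    · subst h
      exact hl.1 (by simp [ha, hb])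
    · exact hr _ _ h.1
  obtain ⟨f⟩ : Nonempty (Fin k ↪ hfin.toFinset) :=
    Function.Embedding.nonempty_of_card_le (by simpa using hc)
  refine ⟨fun j => {(f j : U)}, fun i j hij => ?_, fun j => ?_⟩
  · simpa [Subtype.ext_iff] using fun h => hij (f.injective (Subtype.ext h))
  · have := (hfin.mem_toFinset).1 (f j).2
    exact ⟨f j, this.1, f j, this.2, rfl, .refl⟩

/-- Induction step on the number of edges. If the new edge `x → y` destroys a separator `S` with
fewer than `k` vertices, then adding `x` or `y` to `S` repairs it, so `S` has exactly `k - 1`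
vertices. Links from `A` to `insert x S` and from `insert y S` to `B` are then glued at `S` and
along the new edge. -/
theorem MengerProperty.insert_edge {r r' : U → U → Prop} (hM : MengerProperty r')
    {x y : U} (hxy : ∀ u v, r u v ↔ (u = x ∧ v = y) ∨ r' u v) : MengerProperty r := by
  classical
  intro A B k hk
  by_contra hno
  have hsub : ∀ u v, r' u v → r u v := fun u v h => (hxy u v).2 (Or.inr h)
  have hex : ∃ S : Finset U, IsSeparator r' A B S ∧ S.card < k := by
    by_contra! h
    obtain ⟨W, hW, hl⟩ := hM A B k h
    refine hno ⟨W, hW, fun j => ?_⟩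
    obtain ⟨a, ha, b, hb, h⟩ := hl j
    exact ⟨a, ha, b, hb, h.mono subset_rfl fun u v _ _ => hsub u v⟩
  obtain ⟨S, hS, hSk⟩ := hex
  have hx : IsSeparator r A B (insert x S) := fun a ha b hb hl =>
    hS a ha b hb (hl.mono (fun u hu => by simp at hu ⊢; tauto) fun u v hu _ h => by
      rcases (hxy u v).1 h with h' | h'
      · simp [h'.1] at hu
      · exact h')
  have hy : IsSeparator r A B (insert y S) := fun a ha b hb hl =>
    hS a ha b hb (hl.mono (fun u hu => by simp at hu ⊢; tauto) fun u v _ hv h => by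
      rcases (hxy u v).1 h with h' | h'
      · simp [h'.2] at hv
      · exact h')
  have hkx := hk _ hx
  have hky := hk _ hy
  have hxS : x ∉ S := fun h => by rw [Finset.insert_eq_of_mem h] at hkx; omega
  have hyS : y ∉ S := fun h => by rw [Finset.insert_eq_of_mem h] at hky; omega
  rw [Finset.card_insert_of_notMem hxS] at hkx
  obtain rfl : k = S.card + 1 := by omega
  have hcx : (insert x S).card = S.card + 1 := Finset.card_insert_of_notMem hxS
  have hcy : (insert y S).card = S.card + 1 := Finset.card_insert_of_notMem hyS
  obtain ⟨W, s, hW, hWs⟩ := hM.exists_links_to_separator (r := r) (A := A) (B := B)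
    (Z := insert x S) (k := S.card + 1) (fun u v hu h => by
      rcases (hxy u v).1 h with h' | h'
      · simp [h'.1] at hu
      · exact h') hk hx
  obtain ⟨W', s', hW', hWs'⟩ := hM.swap.exists_links_to_separator (r := Function.swap r) (A := B)
    (B := A) (Z := insert y S) (k := S.card + 1) (fun u v hu h => by
      rcases (hxy v u).1 h with h' | h'
      · simp [h'.2] at hu
      · exact h') (fun T hT => hk T hT.swap) hy.swap
  choose a ha hsZ hl hWC using hWs
  choose b hb hsZ' hl' hWC' using hWs'
  have hsW : ∀ j, s j ∈ W j := fun j => (hl j).mem_right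
  have hsW' : ∀ j, s' j ∈ W' j := fun j => (hl' j).mem_right
  -- The endpoints are `k` distinct elements of a set of `k` elements.
  have hsurj : ∀ w ∈ insert x S, ∃ j, s j = w := by
    have := Finset.surj_on_of_inj_on_of_card_le (s := Finset.univ) (t := insert x S)
      (fun j _ => s j) (fun j _ => hsZ j)
      (fun i j _ _ h => injective_of_mem_disjoint hW hsW (hsW i) h.symm) (by simp [hcx])
    exact fun w hw => (this w hw).imp fun j ⟨_, h⟩ => h.symm
  have hsurj' : ∀ w ∈ insert y S, ∃ j, s' j = w := by
    have := Finset.surj_on_of_inj_on_of_card_le (s := Finset.univ) (t := insert y S)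
      (fun j _ => s' j) (fun j _ => hsZ' j)
      (fun i j _ _ h => injective_of_mem_disjoint hW' hsW' (hsW' i) h.symm) (by simp [hcy])
    exact fun w hw => (this w hw).imp fun j ⟨_, h⟩ => h.symm
  have hmatch : ∀ j, ∃ l, (s j = x ∧ s' l = y) ∨ (s j ∈ S ∧ s' l = s j) := by
    intro j
    rcases Finset.mem_insert.1 (hsZ j) with h | h
    · exact (hsurj' y (Finset.mem_insert_self _ _)).imp fun l hl => Or.inl ⟨h, hl⟩
    · exact (hsurj' (s j) (Finset.mem_insert_of_mem h)).imp fun l hl => Or.inr ⟨h, hl⟩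
  choose σ hσ using hmatch
  have hσinj : ∀ i j, σ i = σ j → i = j := by
    intro i j h
    have hi := hσ i
    have hj := hσ j
    rw [h] at hi
    have hs : s i = s j := by
      rcases hi with hi | hi <;> rcases hj with hj | hj
      · rw [hi.1, hj.1]
      · exact absurd (by rw [← hi.2, hj.2]; exact hj.1) hyS
      · exact absurd (by rw [← hj.2, hi.2]; exact hi.1) hyS
      · rw [← hi.2, hj.2]
    exact injective_of_mem_disjoint hW hsW (hsW i) hs.symm
  -- A common vertex of a first half and a second half lies in `S`, since otherwise `S` would be
  -- bypassed inside `r'`. Being in `S`, it is the endpoint of both halves, so they are matched by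
  -- `σ`.
  have hcross : ∀ j l w, w ∈ W j → w ∈ W' l → l = σ j := by
    intro j l w hw hw'
    have hwS : w ∈ S := by
      by_contra hwS
      obtain ⟨a, ha, h⟩ := exists_linked_of_mem_reachBefore (hWC j hw) (S := S) (by simp) hwS
      obtain ⟨b, hb, h'⟩ := exists_linked_of_mem_reachBefore (hWC' l hw') (S := S) (by simp) hwS
      exact hS a ha b hb (h.trans h'.swap)
    obtain ⟨i, hi⟩ := hsurj w (Finset.mem_insert_of_mem hwS)
    obtain rfl := injective_of_mem_disjoint hW hsW hw hi
    obtain ⟨m, hm⟩ := hsurj' w (Finset.mem_insert_of_mem hwS)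
    obtain rfl := injective_of_mem_disjoint hW' hsW' hw' hm
    rcases hσ j with h | h
    · exact absurd (by rwa [← h.1, hi]) hxS
    · exact injective_of_mem_disjoint hW' hsW' (hsW' l) (by rw [h.2, hi, hm])
  refine hno ⟨fun j => W j ∪ W' (σ j), fun i j hij => ?_, fun j => ⟨a j, ha j, b (σ j), hb _, ?_⟩⟩
  · have hσij : σ i ≠ σ j := fun h => hij (hσinj i j h)
    refine Set.disjoint_left.2 ?_
    rintro w (hw | hw) (hw' | hw')
    · exact Set.disjoint_left.1 (hW hij) hw hw'
    · exact hσij (hcross i _ w hw hw').symm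
    · exact hσij (hcross j _ w hw' hw)
    · exact Set.disjoint_left.1 (hW' hσij) hw hw'
  · have h1 : Linked r (W j ∪ W' (σ j)) (a j) (s j) :=
      (hl j).mono Set.subset_union_left fun u v _ _ => hsub u v
    have h2 : Linked r (W j ∪ W' (σ j)) (s' (σ j)) (b (σ j)) :=
      (hl' (σ j)).swap.mono Set.subset_union_right fun u v _ _ => hsub u v
    rcases hσ j with h | h
    · exact (h1.tail (by rw [h.1, h.2]; exact (hxy x y).2 (Or.inl ⟨rfl, rfl⟩)) h2.1).trans h2
    · exact h1.trans (h.2 ▸ h2)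

/-- **Menger's theorem** for vertex-disjoint links between two sets in a finite digraph. -/
theorem mengerProperty [Finite U] (r : U → U → Prop) : MengerProperty r := by
  classical
  have : ∀ F : Finset (U × U), MengerProperty fun u v => (u, v) ∈ F := by
    intro F
    induction F using Finset.induction_on with
    | empty => exact mengerProperty_of_isEmpty (by simp)
    | insert e F _ ih => exact ih.insert_edge (x := e.1) (y := e.2) (by simp [Prod.ext_iff])
  simpa using this (Set.toFinite {e : U × U | r e.1 e.2}).toFinset

/-- Some separator has as many vertices as there are disjoint links. -/
theorem exists_separator_and_links [Finite U] (r : U → U → Prop) (A B : Set U) :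
    ∃ S : Finset U, IsSeparator r A B S ∧ HasDisjointLinks r A B S.card := by
  classical
  have hne : ∃ n, ∃ S : Finset U, IsSeparator r A B S ∧ S.card = n :=
    ⟨_, (Set.toFinite A).toFinset, fun a ha b _ h => h.1 (by simpa using ha), rfl⟩
  obtain ⟨S, hS, hSn⟩ := Nat.find_spec hne
  refine ⟨S, hS, mengerProperty r A B _ fun S' hS' => ?_⟩
  rw [hSn]
  exact Nat.find_min' hne ⟨S', hS', rfl⟩

end Menger

/-! ### The quantum max-flow is at least the number of disjoint links of qubits -/

/-- With `c = ⌊log₂ d⌋` one has `d ≤ 2 ^ (c + 1) - 1 ≤ 3 ^ c`. -/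
theorem le_three_pow_log_two (d : ℕ) : d ≤ 3 ^ Nat.log 2 d := by
  have h1 : d < 2 ^ (Nat.log 2 d + 1) := Nat.lt_pow_succ_log_self one_lt_two d
  have h2 : ∀ c : ℕ, 2 ^ (c + 1) ≤ 3 ^ c + 1 := by
    intro c
    induction c with
    | zero => norm_num
    | succ c ih =>
      have : 1 ≤ 3 ^ c := Nat.one_le_pow _ _ (by norm_num)
      rw [pow_succ, pow_succ 3]
      omega
  have := h2 (Nat.log 2 d)
  omega

theorem logb_two_le_mul_log {d : ℕ} (hd : 0 < d) :
    Real.logb 2 d ≤ Real.logb 2 3 * (Nat.log 2 d : ℝ) := by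
  have h : (d : ℝ) ≤ 3 ^ Nat.log 2 d := by exact_mod_cast le_three_pow_log_two d
  calc Real.logb 2 d ≤ Real.logb 2 (3 ^ Nat.log 2 d) :=
        Real.logb_le_logb_of_le one_lt_two (by exact_mod_cast hd) h
    _ = _ := by rw [Real.logb_pow, mul_comm]

namespace TensorNetworkTemplate

variable {V : Type u} [DecidableEq V] (T : TensorNetworkTemplate V)

/-- Each edge `e` can carry `⌊log₂ d(e)⌋` qubits. -/
abbrev EdgeQubit : Type u := Σ e : T.E, Fin (Nat.log 2 (T.d e))

variable {T}

/-- The edge carrying the qubit `u` is incident on `v`. -/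
def EdgeQubit.Touches (u : T.EdgeQubit) (v : V) : Prop := u.1.1.1 = v ∨ u.1.1.2 = v

/-- The edges carrying the two qubits share a filled vertex. -/
def EdgeQubit.Meets (u u' : T.EdgeQubit) : Prop := ∃ v ∈ T.filled, u.Touches v ∧ u'.Touches v

variable (T)

/-- The qubits on the ingoing edges. -/
def inQubits : Set T.EdgeQubit := {u | u.1.1.1 ∉ T.filled ∧ u.1.1.2 ∈ T.filled}

/-- The qubits on the outgoing edges. -/
def outQubits : Set T.EdgeQubit := {u | u.1.1.1 ∈ T.filled ∧ u.1.1.2 ∉ T.filled}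

/-! ### Separators of qubits yield cuts. -/

/-- The source side of the cut given by a set `S` of removed qubits. -/
def sourceSide (S : Finset T.EdgeQubit) : Set T.FlowVertex
  | .source => True
  | .sink => False
  | .node v => ∃ a ∈ T.inQubits, ∃ w, Linked EdgeQubit.Meets (↑S)ᶜ a w ∧ w.Touches v

/-- The template edge from which an edge of the flow network comes. -/
def FlowEdge.edge {T : TensorNetworkTemplate V} : T.FlowEdge → T.E
  | .inl e => e
  | .inr e => e.1

variable {T}

theorem flowNetwork_cap (f : T.FlowEdge) :
    T.flowNetwork.cap f = Real.logb 2 (T.d (FlowEdge.edge f) : ℕ) := by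
  rcases f with e | e <;> rfl

theorem exists_linked_of_node_mem_sourceSide {S : Finset T.EdgeQubit} {v : V} (hv : v ∈ T.filled)
    (h : FlowVertex.node ⟨v, hv⟩ ∈ T.sourceSide S) {u : T.EdgeQubit} (hu : u ∉ S)
    (huv : u.Touches v) : ∃ a ∈ T.inQubits, Linked EdgeQubit.Meets (↑S)ᶜ a u := by
  obtain ⟨a, ha, w, hl, hw⟩ := h
  exact ⟨a, ha, hl.tail ⟨v, hv, hw, huv⟩ (by simpa using hu)⟩

/-- A qubit outside `S` on a crossing edge would be reachable: it would put the head on the source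
side or, on an outgoing edge, link `inQubits` to `outQubits`. -/
theorem mem_of_crosses_sourceSide {S : Finset T.EdgeQubit}
    (hS : IsSeparator EdgeQubit.Meets T.inQubits T.outQubits S) {f : T.FlowEdge}
    (ht : T.flowNetwork.tail f ∈ T.sourceSide S) (hh : T.flowNetwork.head f ∉ T.sourceSide S)
    (i : Fin (Nat.log 2 (T.d (FlowEdge.edge f)))) :
    (⟨FlowEdge.edge f, i⟩ : T.EdgeQubit) ∈ S := by
  by_contra hu
  rcases f with e | e
  · by_cases h1 : e.1.1 ∈ T.filled
    · have ht' : FlowVertex.node ⟨e.1.1, h1⟩ ∈ T.sourceSide S := by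
        simpa [flowNetwork, h1] using ht
      obtain ⟨a, ha, hl⟩ := exists_linked_of_node_mem_sourceSide h1 ht' hu (Or.inl rfl)
      by_cases h2 : e.1.2 ∈ T.filled
      · refine hh ?_
        simp only [flowNetwork, h2, dite_true]
        exact ⟨a, ha, _, hl, Or.inr rfl⟩
      · exact hS a ha _ ⟨h1, h2⟩ hl
    · have h2 : e.1.2 ∈ T.filled := T.empty_adj_filled _ _ h1 (Or.inl e.2)
      refine hh ?_
      simp only [flowNetwork, h2, dite_true]
      exact ⟨⟨e, i⟩, ⟨h1, h2⟩, ⟨e, i⟩, ⟨hu, .refl⟩, Or.inr rfl⟩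
  · obtain ⟨a, ha, hl⟩ := exists_linked_of_node_mem_sourceSide e.2.2 ht hu (Or.inr rfl)
    exact hh ⟨a, ha, _, hl, Or.inl rfl⟩

/-- An internal edge and its reversal cross a cut in opposite directions, so no template edge is
counted twice. -/
theorem edge_injOn_crossing (C : Set T.FlowVertex) :
    Set.InjOn FlowEdge.edge {f : T.FlowEdge | T.flowNetwork.tail f ∈ C ∧
      T.flowNetwork.head f ∉ C} := by
  have key : ∀ (e : T.E) (e' : T.InternalEdge), e = e'.1 →
      T.flowNetwork.tail (.inr e') ∈ C → T.flowNetwork.head (.inl e) ∉ C → False := by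
    rintro e e' rfl h1 h2
    refine h2 ?_
    simpa [flowNetwork, e'.2.2] using h1
  rintro (e | e) he (e' | e') he' h
  · exact congrArg Sum.inl h
  · exact (key e e' h he'.1 he.2).elim
  · exact (key e' e h.symm he.1 he'.2).elim
  · exact congrArg Sum.inr (Subtype.ext h)

theorem minCut_le_of_isSeparator {S : Finset T.EdgeQubit}
    (hS : IsSeparator EdgeQubit.Meets T.inQubits T.outQubits S) :
    T.minCut ≤ Real.logb 2 3 * (S.card : ℝ) := by
  classical
  have hcut : T.flowNetwork.IsCut (T.sourceSide S) (T.sourceSide S)ᶜ :=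
    ⟨disjoint_compl_right, Set.union_compl_self _, trivial, fun h => h⟩
  refine (T.flowNetwork.isLeast_minCut.2 ⟨_, _, hcut, rfl⟩).trans ?_
  unfold FlowNetwork.cutCapacity
  set F : Finset T.FlowEdge := Finset.univ.filter fun f => T.flowNetwork.tail f ∈ T.sourceSide S ∧
    T.flowNetwork.head f ∈ (T.sourceSide S)ᶜ with hF
  have hmem : ∀ f ∈ F, T.flowNetwork.tail f ∈ T.sourceSide S ∧
    T.flowNetwork.head f ∉ T.sourceSide S := fun f hf => by simpa [hF] using hf
  have hinj : Set.InjOn FlowEdge.edge (F : Set T.FlowEdge) :=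
    (edge_injOn_crossing (T.sourceSide S)).mono fun f hf => hmem f hf
  have hcard : ∑ f ∈ F, Nat.log 2 (T.d (FlowEdge.edge f)) ≤ S.card := by
    calc ∑ f ∈ F, Nat.log 2 (T.d (FlowEdge.edge f))
        = ((F.image FlowEdge.edge).sigma
            fun e => (Finset.univ : Finset (Fin (Nat.log 2 (T.d e))))).card := by
          rw [Finset.card_sigma, Finset.sum_image hinj]
          simp
      _ ≤ S.card := by
          refine Finset.card_le_card ?_
          rintro ⟨e, i⟩ hu
          obtain ⟨f, hf, rfl⟩ := Finset.mem_image.1 (Finset.mem_sigma.1 hu).1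
          exact mem_of_crosses_sourceSide hS (hmem f hf).1 (hmem f hf).2 i
  have h3 : 0 ≤ Real.logb 2 3 := Real.logb_nonneg one_lt_two (by norm_num)
  calc _ = ∑ f ∈ F, T.flowNetwork.cap f := Finset.sum_congr (by ext; simp [hF]) fun _ _ => rfl
    _ ≤ ∑ f ∈ F, Real.logb 2 3 * (Nat.log 2 (T.d (FlowEdge.edge f)) : ℝ) :=
        Finset.sum_le_sum fun f _ => by
          rw [flowNetwork_cap]
          exact logb_two_le_mul_log (T.d _).pos
    _ = Real.logb 2 3 * ((∑ f ∈ F, Nat.log 2 (T.d (FlowEdge.edge f)) : ℕ) : ℝ) := by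
        rw [← Finset.mul_sum]
        push_cast
        rfl
    _ ≤ _ := mul_le_mul_of_nonneg_left (by exact_mod_cast hcard) h3

/-! ### Tensors carrying one bit along each link. -/

open Classical in
/-- The tensors that force all the qubits of the same class at a vertex to be equal. -/
noncomputable def classFilling {k : ℕ}
    (bits : (e : T.E) → Fin (T.d e) → Fin (Nat.log 2 (T.d e)) → Bool)
    (W : Fin k → Set T.EdgeQubit) : T.Filling := fun v x =>
  if ∀ (j : Fin k) (u u' : T.EdgeQubit) (hu : u.Touches v) (hu' : u'.Touches v), u ∈ W j →
    u' ∈ W j → bits u.1 (x ⟨u.1, hu⟩) u.2 = bits u'.1 (x ⟨u'.1, hu'⟩) u'.2 then 1 else 0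

theorem classFilling_ne_zero_iff {k : ℕ}
    {bits : (e : T.E) → Fin (T.d e) → Fin (Nat.log 2 (T.d e)) → Bool}
    {W : Fin k → Set T.EdgeQubit} {v : T.filled} {x : (e : T.Incident v) → Fin (T.d e.1)} :
    classFilling bits W v x ≠ 0 ↔ ∀ (j : Fin k) (u u' : T.EdgeQubit) (hu : u.Touches v)
      (hu' : u'.Touches v), u ∈ W j → u' ∈ W j →
        bits u.1 (x ⟨u.1, hu⟩) u.2 = bits u'.1 (x ⟨u'.1, hu'⟩) u'.2 := by
  classical
  unfold classFilling
  rw [ite_ne_right_iff]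
  simp

theorem eq_of_linked_of_classFilling_ne_zero {k : ℕ}
    {bits : (e : T.E) → Fin (T.d e) → Fin (Nat.log 2 (T.d e)) → Bool}
    {W : Fin k → Set T.EdgeQubit} {x : T.Index}
    (hx : ∀ v : T.filled, classFilling bits W v (fun e => x e.1) ≠ 0) {j : Fin k}
    {a b : T.EdgeQubit} (h : Linked EdgeQubit.Meets (W j) a b) :
    bits a.1 (x a.1) a.2 = bits b.1 (x b.1) b.2 := by
  obtain ⟨-, h⟩ := h
  induction h with
  | refl => rfl
  | @tail b c _ hbc ih =>
    obtain ⟨⟨v, hv, hb, hc⟩, hbW, hcW⟩ := hbc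
    exact ih.trans (classFilling_ne_zero_iff.1 (hx ⟨v, hv⟩) j b c hb hc hbW hcW)

theorem exists_bits (d : ℕ+) : ∃ (enc : (Fin (Nat.log 2 d) → Bool) → Fin d)
    (bits : Fin d → Fin (Nat.log 2 d) → Bool), ∀ b, bits (enc b) = b := by
  obtain ⟨f⟩ : Nonempty ((Fin (Nat.log 2 d) → Bool) ↪ Fin d) :=
    Function.Embedding.nonempty_of_card_le (by simpa using Nat.pow_log_le_self 2 d.ne_zero)
  exact ⟨f, Function.invFun f, Function.leftInverse_invFun f.injective⟩

theorem exists_filling_of_hasDisjointLinks {k : ℕ}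
    (h : HasDisjointLinks EdgeQubit.Meets T.inQubits T.outQubits k) :
    ∃ N : T.Filling, 2 ^ k ≤ (T.operator N).rank := by
  classical
  obtain ⟨W, hW, hl⟩ := h
  choose enc bits hbits using fun e : T.E => exists_bits (T.d e)
  -- The bit `y j` is written on every qubit of `W j`, and `false` on the unused qubits.
  let asg : (Fin k → Bool) → T.Index := fun y e =>
    enc e fun i => if h : ∃ j, (⟨e, i⟩ : T.EdgeQubit) ∈ W j then y h.choose else false
  have hasg : ∀ y (u : T.EdgeQubit) j, u ∈ W j → bits u.1 (asg y u.1) u.2 = y j := by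
    intro y u j hu
    have hex : ∃ j, (⟨u.1, u.2⟩ : T.EdgeQubit) ∈ W j := ⟨j, hu⟩
    have hj : hex.choose = j := by
      by_contra hne
      exact Set.disjoint_left.1 (hW hne) hex.choose_spec hu
    simp only [asg, hbits, dif_pos hex, hj]
  have hprod : ∀ x : T.Index, ∏ v : T.filled, classFilling bits W v (fun e => x e.1) =
      if ∀ v : T.filled, classFilling bits W v (fun e => x e.1) ≠ 0 then 1 else 0 := by
    intro x
    split_ifs with hx
    · refine Finset.prod_eq_one fun v _ => ?_
      exact if_pos (classFilling_ne_zero_iff.1 (hx v))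
    · push Not at hx
      obtain ⟨v, hv⟩ := hx
      exact Finset.prod_eq_zero (Finset.mem_univ v) hv
  let w : (Fin k → Bool) → ℂ := fun y =>
    T.operator (classFilling bits W) (fun e => asg y e.1) (fun e => asg y e.1)
  have hdiag : (T.operator (classFilling bits W)).submatrix
      (fun (y : Fin k → Bool) e => asg y e.1) (fun y e => asg y e.1) = Matrix.diagonal w := by
    ext y z
    rcases eq_or_ne y z with rfl | hyz
    · simp [w]
    -- A nonzero term would carry each input bit `z j` unchanged to the output bit `y j`.
    · rw [Matrix.diagonal_apply_ne _ hyz, Matrix.submatrix_apply, operator]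
      refine Finset.sum_eq_zero fun x hx => ?_
      rw [hprod, if_neg]
      intro hne
      refine hyz (funext fun j => ?_)
      obtain ⟨a, ha, b, hb, hab⟩ := hl j
      have hx := (Finset.mem_filter.1 hx).2
      have := eq_of_linked_of_classFilling_ne_zero hne hab
      rw [hx.1 ⟨b.1, hb⟩, hx.2 ⟨a.1, ha⟩] at this
      rw [← hasg y b j hab.mem_right, ← hasg z a j hab.1]
      exact this.symm
  -- Every term is 0 or 1, so nothing cancels: a diagonal entry counts assignments, among them `asg
  -- y`.
  have hw : ∀ y, w y ≠ 0 := by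
    intro y
    simp only [w, operator, hprod, Finset.sum_boole]
    rw [Nat.cast_ne_zero, ← Nat.pos_iff_ne_zero, Finset.card_pos]
    refine ⟨asg y, Finset.mem_filter.2 ⟨by simp, fun v => ?_⟩⟩
    refine classFilling_ne_zero_iff.2 fun j u u' _ _ hu hu' => ?_
    exact (hasg y u j hu).trans (hasg y u' j hu').symm
  refine ⟨classFilling bits W, ?_⟩
  refine le_trans ?_ (Matrix.rank_submatrix_le (T.operator (classFilling bits W))
      (fun (y : Fin k → Bool) e => asg y e.1) (fun y e => asg y e.1))
  rw [hdiag, Matrix.rank_diagonal]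
  simp [hw]

theorem natCast_le_quantumMaxFlow {k : ℕ}
    (h : HasDisjointLinks EdgeQubit.Meets T.inQubits T.outQubits k) :
    (k : ℝ) ≤ T.quantumMaxFlow := by
  obtain ⟨N, hN⟩ := exists_filling_of_hasDisjointLinks h
  refine le_trans ?_ (T.isGreatest_quantumMaxFlow.2 ⟨_, ⟨N, rfl⟩, rfl⟩)
  rw [Real.le_logb_iff_rpow_le one_lt_two (by exact_mod_cast lt_of_lt_of_le (by positivity) hN),
    Real.rpow_natCast]
  exact_mod_cast hN

variable (T) in
theorem minCut_le_logb_three_mul_quantumMaxFlow :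
    T.minCut ≤ Real.logb 2 3 * T.quantumMaxFlow := by
  obtain ⟨S, hS, hl⟩ := exists_separator_and_links EdgeQubit.Meets T.inQubits T.outQubits
  exact (minCut_le_of_isSeparator hS).trans (mul_le_mul_of_nonneg_left
    (natCast_le_quantumMaxFlow hl) (Real.logb_nonneg one_lt_two (by norm_num)))

end TensorNetworkTemplate

/-! ### Exact compression and rank -/

open Matrix

section Channels

variable {m n ι : Type*} [Fintype m] [Fintype ι]

/-- The completely positive map with Kraus operators `K a`. -/
noncomputable def krausMap (K : ι → Matrix n m ℂ) : Matrix m m ℂ →ₗ[ℂ] Matrix n n ℂ where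
  toFun M := ∑ a, K a * M * (K a)ᴴ
  map_add' M M' := by simp [Matrix.mul_add, Matrix.add_mul, Finset.sum_add_distrib]
  map_smul' c M := by simp [Finset.smul_sum]

theorem krausMap_apply (K : ι → Matrix n m ℂ) (M : Matrix m m ℂ) :
    krausMap K M = ∑ a, K a * M * (K a)ᴴ := rfl

theorem mul_pureState_mul_conjTranspose (B : Matrix n m ℂ) (ψ : m → ℂ) :
    B * pureState ψ * Bᴴ = pureState (B *ᵥ ψ) := by
  rw [pureState, pureState, mul_vecMulVec, vecMulVec_mul, star_mulVec]

theorem krausMap_pureState (K : ι → Matrix n m ℂ) (ψ : m → ℂ) :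
    krausMap K (pureState ψ) = ∑ a, pureState (K a *ᵥ ψ) := by
  simp only [krausMap_apply, mul_pureState_mul_conjTranspose]

-- The map `id_r ⊗ Φ` has Kraus operators `1 ⊗ K a`, hence is a sum of congruences.
open Kronecker in
theorem isQuantumChannel_krausMap {m n : Type u} [Fintype m] [Fintype n] [DecidableEq m]
    {K : ι → Matrix n m ℂ} (hK : ∑ a, (K a)ᴴ * K a = 1) : IsQuantumChannel (krausMap K) := by
  refine ⟨fun M => ?_, fun r M hM => ?_⟩
  · rw [krausMap_apply, trace_sum]
    simp only [fun a => trace_mul_cycle (K a) M (K a)ᴴ]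
    rw [← trace_sum, ← Finset.sum_mul, hK, one_mul]
  · have : (of fun (x y : Fin r × n) =>
        krausMap K (of fun (i j : m) => M (x.1, i) (y.1, j)) x.2 y.2) =
        ∑ a, ((1 : Matrix (Fin r) (Fin r) ℂ) ⊗ₖ K a) * M *
          ((1 : Matrix (Fin r) (Fin r) ℂ) ⊗ₖ K a)ᴴ := by
      ext ⟨x, i⟩ ⟨y, j⟩
      simp [krausMap_apply, Matrix.sum_apply, Matrix.mul_apply, Fintype.sum_prod_type,
        Matrix.one_apply, apply_ite, ite_mul]
    rw [this]
    exact posSemidef_sum _ fun a _ => hM.mul_mul_conjTranspose_same _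

/-- A partial isometry extends to a channel which acts on its initial space by conjugation. -/
theorem exists_channel_of_partialIsometry {m n : Type u} [Fintype m] [Fintype n] [DecidableEq m]
    [Nonempty n] {W : Matrix n m ℂ} (hW : W * Wᴴ * W = W) :
    ∃ Φ : Matrix m m ℂ →ₗ[ℂ] Matrix n n ℂ, IsQuantumChannel Φ ∧
      ∀ ψ, Wᴴ *ᵥ (W *ᵥ ψ) = ψ → Φ (pureState ψ) = pureState (W *ᵥ ψ) := by
  classical
  obtain ⟨i⟩ := ‹Nonempty n›
  let P : Matrix m m ℂ := 1 - Wᴴ * W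
  have hP : Pᴴ = P := by simp [P]
  have hPP : P * P = P := by
    have : Wᴴ * W * (Wᴴ * W) = Wᴴ * W := by
      rw [Matrix.mul_assoc, ← Matrix.mul_assoc W, hW]
    simp only [P, mul_sub, sub_mul, Matrix.one_mul, Matrix.mul_one, this]
    abel
  -- The additional Kraus operators send the orthogonal complement of the initial space to the basis
  -- vector `i`; they restore the trace and vanish on the initial space.
  let K : Option m → Matrix n m ℂ := fun o => o.elim W fun l => (single i l 1 : Matrix n m ℂ) * P
  refine ⟨krausMap K, isQuantumChannel_krausMap ?_, fun ψ hψ => ?_⟩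
  · have h1 : ∑ l : m, ((single i l 1 : Matrix n m ℂ) * P)ᴴ *
        ((single i l 1 : Matrix n m ℂ) * P) = P := by
      have : ∀ l : m, ((single i l 1 : Matrix n m ℂ) * P)ᴴ * ((single i l 1 : Matrix n m ℂ) * P)
          = P * (single l l 1 : Matrix m m ℂ) * P := by
        intro l
        have h : (single i l 1 : Matrix n m ℂ)ᴴ * (single i l 1 : Matrix n m ℂ) = single l l 1 := by
          rw [conjTranspose_single, single_mul_single_same, star_one, one_mul]
        rw [conjTranspose_mul, hP, ← h]
        simp only [Matrix.mul_assoc]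
      simp only [this]
      rw [← Finset.sum_mul, ← Finset.mul_sum, sum_single_one, Matrix.mul_one, hPP]
    rw [Fintype.sum_option]
    simp only [K, Option.elim]
    rw [h1]
    simp [P]
  · rw [krausMap_pureState, Fintype.sum_option]
    have h0 : P *ᵥ ψ = 0 := by
      simp only [P, sub_mulVec, one_mulVec, ← mulVec_mulVec, hψ, sub_self]
    simp only [K, Option.elim, ← mulVec_mulVec, h0, mulVec_zero]
    simp [pureState]

/-- An orthonormal basis of the range of a matrix, as the columns of a matrix. -/
theorem exists_orthonormal_range [Fintype n] (A : Matrix m n ℂ) :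
    ∃ (B : Matrix m (Fin A.rank) ℂ) (C : Matrix n (Fin A.rank) ℂ), A * C = B ∧ Bᴴ * B = 1 ∧
      ∀ v, B *ᵥ (Bᴴ *ᵥ (A *ᵥ v)) = A *ᵥ v := by
  classical
  let S := LinearMap.range (toEuclideanLin A)
  have hS : Module.finrank ℂ S = A.rank := by
    rw [rank_eq_finrank_range_toLin A (PiLp.basisFun 2 ℂ m) (PiLp.basisFun 2 ℂ n)]
    rw [← toLpLin_eq_toLin]
  let b : OrthonormalBasis (Fin A.rank) ℂ S := (stdOrthonormalBasis ℂ S).reindex (finCongr hS)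
  -- Preimages under `A` of the basis vectors: the columns of `C`.
  choose c hc using fun j => (b j).2
  refine ⟨of fun i j => (b j : EuclideanSpace ℂ m) i, of fun i j => c j i, ?_, ?_, fun v => ?_⟩
  · ext i j
    have := congrArg (fun x : EuclideanSpace ℂ m => x i) (hc j)
    simpa [Matrix.mul_apply, toLpLin_apply, mulVec, dotProduct] using this
  · ext j k
    have := orthonormal_iff_ite.1 b.orthonormal j k
    rw [Submodule.coe_inner, PiLp.inner_apply] at this
    simp only [Matrix.mul_apply, conjTranspose_apply, of_apply, Matrix.one_apply, ← this]
    refine Finset.sum_congr rfl fun i _ => ?_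
    simp [mul_comm]
  · let x : S := ⟨toEuclideanLin A (WithLp.toLp 2 v), LinearMap.mem_range_self _ _⟩
    have hx : ∀ i, (x : EuclideanSpace ℂ m) i = (A *ᵥ v) i := fun i => by
      simp [x]
    have := congrArg (fun y : S => (y : EuclideanSpace ℂ m)) (b.sum_repr' x)
    funext i
    have h := congrArg (fun y : EuclideanSpace ℂ m => y i) this
    simp only [Submodule.coe_sum, Submodule.coe_smul, Submodule.coe_inner] at h
    rw [← hx i, ← h]
    simp only [mulVec, dotProduct, of_apply, conjTranspose_apply, PiLp.inner_apply, hx,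
      WithLp.ofLp_sum, WithLp.ofLp_smul, Finset.sum_apply, Pi.smul_apply, smul_eq_mul]
    refine Finset.sum_congr rfl fun j _ => ?_
    rw [mul_comm]
    congr 1
    refine Finset.sum_congr rfl fun l _ => ?_
    simp [mul_comm]

/-- Encode with `J * Bᴴ`, which maps the range of `A` isometrically into the qubits, and decode with
its adjoint. -/
theorem exactlyCompressible_of_rank_le {m : Type u} [Fintype m] [Nonempty m] [Fintype n]
    (A : Matrix m n ℂ)
    {q : ℕ} (hq : A.rank ≤ 2 ^ q) {X : Type} (v : X → n → ℂ) :
    ExactlyCompressible (fun x => A *ᵥ v x) q := by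
  classical
  obtain ⟨B, -, -, hB, hBA⟩ := exists_orthonormal_range A
  obtain ⟨f⟩ : Nonempty (Fin A.rank ↪ QubitIndex.{u} q) :=
    Function.Embedding.nonempty_of_card_le (by simpa using hq)
  let J : Matrix (QubitIndex.{u} q) (Fin A.rank) ℂ := of fun k j => if k = f j then 1 else 0
  have hJ : Jᴴ * J = 1 := by
    ext i j
    simp [J, Matrix.mul_apply, Matrix.one_apply, f.injective.eq_iff, eq_comm, apply_ite]
  let W : Matrix (QubitIndex.{u} q) m ℂ := J * Bᴴ
  have hWW : Wᴴ * W = B * Bᴴ := by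
    simp only [W, conjTranspose_mul, conjTranspose_conjTranspose]
    rw [Matrix.mul_assoc, ← Matrix.mul_assoc Jᴴ, hJ, Matrix.one_mul]
  have hW : W * Wᴴ * W = W := by
    rw [Matrix.mul_assoc, hWW]
    simp only [W]
    rw [Matrix.mul_assoc, ← Matrix.mul_assoc Bᴴ, hB, Matrix.one_mul]
  have hW' : Wᴴ * Wᴴᴴ * Wᴴ = Wᴴ := by
    simpa [Matrix.mul_assoc] using congrArg conjTranspose hW
  obtain ⟨enc, henc, he⟩ := exists_channel_of_partialIsometry hW
  obtain ⟨dec, hdec, hd⟩ := exists_channel_of_partialIsometry hW'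
  refine ⟨enc, dec, henc, hdec, fun x => ?_⟩
  have hx : Wᴴ *ᵥ (W *ᵥ (A *ᵥ v x)) = A *ᵥ v x := by
    rw [mulVec_mulVec, hWW, ← mulVec_mulVec, hBA]
  rw [he _ hx, hd _ (by rw [hx, conjTranspose_conjTranspose]), hx]

/-- Rescaling removes the normalisation, and polarisation with `c + d` and `c + I • d` reaches all
rank-one matrices, which span. -/
theorem linearMap_eq_zero_of_pureState {k : Type*} [Fintype k] {E : Type*} [AddCommGroup E]
    [Module ℂ E] {L : Matrix k k ℂ →ₗ[ℂ] E} (h : ∀ c, star c ⬝ᵥ c = 1 → L (pureState c) = 0) :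
    L = 0 := by
  classical
  have h1 : ∀ c, L (pureState c) = 0 := by
    intro c
    by_cases hc : c = 0
    · simp [hc, pureState]
    · have hpos : 0 < star c ⬝ᵥ c := dotProduct_star_self_pos_iff.2 hc
      obtain ⟨hre, him⟩ := Complex.pos_iff.1 hpos
      set ρ : ℝ := (star c ⬝ᵥ c).re
      have hρ : star c ⬝ᵥ c = (ρ : ℂ) := Complex.ext rfl (by simp [← him])
      set t : ℝ := (√ρ)⁻¹
      have ht : t * t * ρ = 1 := by
        rw [← mul_inv, Real.mul_self_sqrt hre.le, inv_mul_cancel₀ hre.ne']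
      have h' := h ((t : ℂ) • c) (by
        rw [star_smul, smul_dotProduct, dotProduct_smul, hρ]
        simp only [Complex.star_def, Complex.conj_ofReal, smul_eq_mul]
        rw [← mul_assoc]
        exact_mod_cast ht)
      rw [pureState, star_smul, smul_vecMulVec, vecMulVec_smul, map_smul, map_smul] at h'
      have ht0 : t ≠ 0 := inv_ne_zero (Real.sqrt_ne_zero'.2 hre)
      simpa [ht0, pureState] using h'
  have h2 : ∀ c d : k → ℂ, L (vecMulVec c (star d)) = 0 := by
    intro c d
    have e1 := h1 (c + d)
    have e2 := h1 (c + Complex.I • d)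
    have ec := h1 c
    have ed := h1 d
    simp only [pureState, star_add, star_smul, vecMulVec_add, add_vecMulVec, smul_vecMulVec,
      vecMulVec_smul, map_add, map_smul] at e1 e2 ec ed
    simp only [ec, ed, smul_zero, zero_add, add_zero, Complex.star_def, Complex.conj_I] at e1 e2
    have e3 := congrArg (Complex.I • ·) e2
    simp only [smul_add, smul_smul, mul_neg, Complex.I_mul_I, neg_neg, smul_zero] at e3
    linear_combination (norm := module) (1 / 2 : ℂ) • e1 + (1 / 2 : ℂ) • e3
  refine LinearMap.ext fun M => ?_
  rw [matrix_eq_sum_single M]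
  rw [LinearMap.zero_apply, map_sum]
  simp only [map_sum]
  refine Finset.sum_eq_zero fun i _ => Finset.sum_eq_zero fun j _ => ?_
  have : single i j (M i j) = vecMulVec (Pi.single i (M i j)) (star (Pi.single j 1)) := by
    ext a b
    by_cases ha : i = a <;> by_cases hb : j = b <;> simp [vecMulVec_apply, *]
  rw [this, h2]

theorem rank_le_of_exactlyCompressible {m : Type u} [Fintype m] [Fintype n]
    (A : Matrix m n ℂ) {q : ℕ}
    (h : ∀ (X : Type) (v : X → n → ℂ), (∀ x, star (A *ᵥ v x) ⬝ᵥ (A *ᵥ v x) = 1) →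
      ExactlyCompressible (fun x => A *ᵥ v x) q) : A.rank ≤ 2 ^ q := by
  classical
  obtain ⟨B, C, hAC, hB, -⟩ := exists_orthonormal_range A
  have hv : ∀ c, A *ᵥ (C *ᵥ c) = B *ᵥ c := fun c => by rw [mulVec_mulVec, hAC]
  -- The worst family consists of all unit vectors of the range, indexed by their coordinates so
  -- that the index set lives in `Type`.
  obtain ⟨enc, dec, -, -, hed⟩ := h {c : Fin A.rank → ℂ // star c ⬝ᵥ c = 1} (fun c => C *ᵥ c.1)
    fun c => by
      rw [hv, star_mulVec, ← dotProduct_mulVec, mulVec_mulVec, hB, one_mulVec, c.2]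
  let conj : Matrix (Fin A.rank) (Fin A.rank) ℂ →ₗ[ℂ] Matrix m m ℂ :=
    krausMap fun _ : Unit => B
  have hconj : ∀ M, conj M = B * M * Bᴴ := fun M => by simp [conj, krausMap_apply]
  have hL : (dec ∘ₗ enc) ∘ₗ conj - conj = 0 := by
    refine linearMap_eq_zero_of_pureState fun c hc => ?_
    have := hed ⟨c, hc⟩
    simp only [hv] at this
    simp [hconj, mul_pureState_mul_conjTranspose, this]
  -- As `dec` recovers `B * M * Bᴴ`, and `Bᴴ * B = 1` recovers `M`, encoding loses nothing;
  -- comparing dimensions gives `r * r ≤ 2 ^ q * 2 ^ q`.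
  have hinj : Function.Injective (enc ∘ₗ conj) := by
    rw [← LinearMap.ker_eq_bot, LinearMap.ker_eq_bot']
    intro M hM
    have h1 : dec (enc (conj M)) = conj M := by
      simpa [sub_eq_zero] using LinearMap.congr_fun hL M
    have h2 : B * M * Bᴴ = 0 := by
      rw [← hconj, ← h1, show enc (conj M) = 0 from hM, map_zero]
    calc M = Bᴴ * B * M * (Bᴴ * B) := by rw [hB, Matrix.one_mul, Matrix.mul_one]
      _ = Bᴴ * (B * M * Bᴴ) * B := by simp only [Matrix.mul_assoc]
      _ = 0 := by rw [h2, Matrix.mul_zero, Matrix.zero_mul]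
  have := LinearMap.finrank_le_finrank_of_injective hinj
  simp only [Module.finrank_matrix, Module.finrank_self, mul_one, Fintype.card_fin,
    Fintype.card_ulift, Fintype.card_fun] at this
  exact Nat.mul_self_le_mul_self_iff.1 this

end Channels

/-! ### The number of qubits needed, and the bounds on `qCut`. -/

namespace TensorNetworkTemplate

variable {V : Type u} [DecidableEq V] (T : TensorNetworkTemplate V)

theorem quantumMaxFlow_le_natCast_iff {q : ℕ} :
    T.quantumMaxFlow ≤ q ↔ ∀ A, T.Compatible A → A.rank ≤ 2 ^ q := by
  have key : ∀ r : ℕ, Real.logb 2 r ≤ q ↔ r ≤ 2 ^ q := by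
    intro r
    -- For rank 0 the convention `Real.logb 2 0 = 0` makes both sides true.
    rcases r.eq_zero_or_pos with rfl | hr
    · simp
    · rw [Real.logb_le_iff_le_rpow one_lt_two (by exact_mod_cast hr), Real.rpow_natCast]
      exact_mod_cast Iff.rfl
  constructor
  · exact fun h A hA => (key _).1 ((T.isGreatest_quantumMaxFlow.2 ⟨A, hA, rfl⟩).trans h)
  · intro h
    obtain ⟨A, hA, hx⟩ := T.isGreatest_quantumMaxFlow.1
    rw [hx]
    exact (key _).2 (h A hA)

theorem qubitsSuffice_iff {q : ℕ} : T.QubitsSuffice q ↔ T.qMin ≤ q := by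
  rw [qMin, Nat.ceil_le, quantumMaxFlow_le_natCast_iff]
  constructor
  · exact fun h A hA => rank_le_of_exactlyCompressible A (h A hA)
  · exact fun h A hA X v _ => exactlyCompressible_of_rank_le A (h A hA) v

theorem minCut_nonneg : 0 ≤ T.minCut := by
  obtain ⟨Cs, Ct, -, h⟩ := T.flowNetwork.isLeast_minCut.1
  rw [minCut, h]
  exact Finset.sum_nonneg fun a _ => T.flowNetwork.cap_nonneg a

theorem qCut_le : (T.qCut : ℝ) ≤ Real.logb 2 3 * (T.qMin : ℝ) + 1 := by
  have h3 : 0 ≤ Real.logb 2 3 := Real.logb_nonneg one_lt_two (by norm_num)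
  calc (T.qCut : ℝ) ≤ T.minCut + 1 := (Nat.ceil_lt_add_one T.minCut_nonneg).le
    _ ≤ _ := by
      gcongr
      exact T.minCut_le_logb_three_mul_quantumMaxFlow.trans
        (mul_le_mul_of_nonneg_left (Nat.le_ceil _) h3)

end TensorNetworkTemplate

theorem proposition3 :
    (∀ (V : Type u) [DecidableEq V] (T : TensorNetworkTemplate V),
      T.minCut ≤ Real.logb 2 3 * T.quantumMaxFlow ∧
      IsLeast {q : ℕ | T.QubitsSuffice q} T.qMin ∧
      (T.qCut : ℝ) ≤ Real.logb 2 3 * (T.qMin : ℝ) + 1) ∧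
    (∀ ε : ℝ, 0 < ε → ∃ K : ℕ, ∀ (V : Type u) [DecidableEq V] (T : TensorNetworkTemplate V),
      K ≤ T.qMin → (T.qCut : ℝ) ≤ (Real.logb 2 3 + ε) * (T.qMin : ℝ)) := by
  refine ⟨fun V _ T => ⟨T.minCut_le_logb_three_mul_quantumMaxFlow,
    ⟨T.qubitsSuffice_iff.2 le_rfl, fun q hq => T.qubitsSuffice_iff.1 hq⟩, T.qCut_le⟩,
    fun ε hε => ⟨⌈1 / ε⌉₊, fun V _ T hK => T.qCut_le.trans ?_⟩⟩
  -- The threshold `⌈1 / ε⌉₊` lets `ε * T.qMin` absorb the additive 1 due to rounding up.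
  have h : 1 ≤ ε * (T.qMin : ℝ) := by
    rw [← div_le_iff₀' hε]
    exact Nat.ceil_le.1 hK
  linarith
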